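/- Let $n\in\mathbb N$ and identify the Heisenberg group $\mathbb H^n$ with $\mathbb R^{2n}\times\mathbb R$. For $\lambda\in\mathbb R\setminus\{0\}$ put $$c_\lambda=(4\pi)^{-n}\lambda^n(\sinh\lambda)^{-n}.$$ For $t>0$ let $$p_t^\lambda(\zeta)=(4\pi)^{-n}\lambda^n(\sinh t\lambda)^{-n}\,e^{-\frac14\lambda(\coth t\lambda)\sum_{i=1}^{2n}\zeta_i^2},\qquad \zeta\in\mathbb C^{2n},$$ be the holomorphic extension of the kernel of the special Hermite semigroup on $\mathbb R^{2n}$. Let $[(z,w),(z',w')]=w\cdot z'-z\cdot w'$ be the (complex bilinear) symplectic form on $\mathbb C^{2n}$. For a function $g\in L^2(\mathbb R^{2n})$ the twisted Bargmann transform is $$B_\lambda g(\zeta)=c_\lambda\,p_1^\lambda(\zeta)^{-1}\int_{\mathbb R^{2n}}g(\eta)\,p_{1/2}^\lambda(\zeta-\eta)\,e^{-i\frac{\lambda}{2}[\zeta,\eta]}\,d\eta,\qquad\zeta\in\mathbb C^{2n},$$ that is, $c_\lambda (p_1^\lambda)^{-1}$ times the holomorphic extension of the $\lambda$-twisted convolution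 $g\ast_\lambda p_{1/2}^\lambda$. Let $$w_\lambda(\zeta)=c_\lambda\,e^{-\frac12\lambda(\coth\lambda)|\zeta|^2}\,e^{\lambda[\operatorname{Re}\zeta,\operatorname{Im}\zeta]}$$ be the weight of the corresponding twisted Fock space, and for a function $f$ on $\mathbb H^n$ let $f^\lambda(\xi)=\int_{\mathbb R}f(\xi,t)e^{i\lambda t}\,dt$. Let $f$ be a Schwartz function on $\mathbb H^n$. Then for all $m,N\in\mathbb N$ there is a constant $C_{m,N}(f)$, depending only on $n,m,N$ and $f$, such that for all $\lambda\in\mathbb R\setminus\{0\}$ and all $\zeta\in\mathbb C^{2n}$ $$|B_\lambda f^\lambda(\zeta)|\,\sqrt{w_\lambda(\zeta)}\le C_{m,N}(f)\,c_\lambda\,(1+\lambda^2)^{-m}\,e^{N|\lambda|}\,(1+|\zeta|)^{-N}.$$ -/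

import Mathlib

open scoped SchwartzMap

noncomputable section

namespace TwistedBargmann

/-- `ℝ²ⁿ`, with its Euclidean norm and Lebesgue measure. A point is `ξ = (x, u)` with
`x j = ξ (.inl j)` and `u j = ξ (.inr j)`. -/
abbrev R2 (n : ℕ) : Type := EuclideanSpace ℝ (Fin n ⊕ Fin n)

/-- `ℂ²ⁿ`, with its Euclidean norm. A point is `ζ = (z, w)` with `z j = ζ (.inl j)` and
`w j = ζ (.inr j)`. -/
abbrev C2 (n : ℕ) : Type := EuclideanSpace ℂ (Fin n ⊕ Fin n)

/-- The underlying manifold `ℝ²ⁿ × ℝ` of the Heisenberg group; the second factor is the central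
variable. -/
abbrev Heis (n : ℕ) : Type := R2 n × ℝ

/-- The inclusion `ℝ²ⁿ ⊆ ℂ²ⁿ`. -/
def toC {n : ℕ} (ξ : R2 n) : C2 n := WithLp.toLp 2 fun i => (ξ i : ℂ)

/-- The coordinatewise real part of `ζ ∈ ℂ²ⁿ`. -/
def rePart {n : ℕ} (ζ : C2 n) : R2 n := WithLp.toLp 2 fun i => (ζ i).re

/-- The coordinatewise imaginary part of `ζ ∈ ℂ²ⁿ`. -/
def imPart {n : ℕ} (ζ : C2 n) : R2 n := WithLp.toLp 2 fun i => (ζ i).im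

/-- The symplectic form `[(x, u), (y, v)] = u · y - v · x` on `ℝ²ⁿ`. -/
def symp {n : ℕ} (ξ η : R2 n) : ℝ :=
  ∑ j, (ξ (.inr j) * η (.inl j) - η (.inr j) * ξ (.inl j))

/-- The complex bilinear extension of the symplectic form to `ℂ²ⁿ`. -/
def sympC {n : ℕ} (ζ ζ' : C2 n) : ℂ :=
  ∑ j, (ζ (.inr j) * ζ' (.inl j) - ζ' (.inr j) * ζ (.inl j))

/-- The hyperbolic cotangent. -/
def coth (x : ℝ) : ℝ := Real.cosh x / Real.sinh x

/-- The constant `c_λ = (4π)⁻ⁿ λⁿ (sinh λ)⁻ⁿ`. -/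
def cConst (n : ℕ) (lam : ℝ) : ℝ :=
  ((4 * Real.pi) ^ n)⁻¹ * lam ^ n * (Real.sinh lam ^ n)⁻¹

/-- The kernel `p_t^λ` of the special Hermite semigroup, extended holomorphically to `ℂ²ⁿ`:
`|x|² + |u|²` becomes `∑ z_j² + ∑ w_j²`. -/
def heatKernel (n : ℕ) (t lam : ℝ) (ζ : C2 n) : ℂ :=
  ((((4 * Real.pi) ^ n)⁻¹ * lam ^ n * (Real.sinh (t * lam) ^ n)⁻¹ : ℝ) : ℂ) *
    Complex.exp (-(1 / 4) * (lam : ℂ) * (coth (t * lam) : ℂ) * ∑ i, ζ i ^ 2)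

/-- The `λ`-twisted convolution `g ∗_λ k` of a function `g` on `ℝ²ⁿ` with a function `k` that is
defined on `ℂ²ⁿ`, evaluated at points of `ℂ²ⁿ`:
`(g ∗_λ k)(ζ) = ∫ g(η) k(ζ - η) e^{-i (λ/2) [ζ, η]} dη`. -/
def twistedConv {n : ℕ} (lam : ℝ) (g : R2 n → ℂ) (k : C2 n → ℂ) (ζ : C2 n) : ℂ :=
  ∫ η : R2 n, g η * k (ζ - toC η) *
    Complex.exp (-Complex.I * ((lam : ℂ) / 2) * sympC ζ (toC η))

/-- The twisted Bargmann transform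
`B_λ g(ζ) = c_λ p_1^λ(ζ)⁻¹ (g ∗_λ p_{1/2}^λ)(ζ)`. -/
def bargmann {n : ℕ} (lam : ℝ) (g : R2 n → ℂ) (ζ : C2 n) : ℂ :=
  (cConst n lam : ℂ) * (heatKernel n 1 lam ζ)⁻¹ *
    twistedConv lam g (heatKernel n (1 / 2) lam) ζ

/-- The weight `w_λ(ζ) = c_λ e^{-(λ/2) (coth λ) |ζ|²} e^{λ [Re ζ, Im ζ]}` of the twisted Fock
space. -/
def weight {n : ℕ} (lam : ℝ) (ζ : C2 n) : ℝ :=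
  cConst n lam * Real.exp (-(1 / 2) * lam * coth lam * ‖ζ‖ ^ 2) *
    Real.exp (lam * symp (rePart ζ) (imPart ζ))

/-- The inverse Fourier transform in the central variable,
`f^λ(ξ) = ∫ f(ξ, t) e^{iλt} dt`. -/
def centralFourier {n : ℕ} (f : Heis n → ℂ) (lam : ℝ) (ξ : R2 n) : ℂ :=
  ∫ t : ℝ, f (ξ, t) * Complex.exp (Complex.I * (lam : ℂ) * (t : ℂ))

end TwistedBargmann

end

/-!
Twisted convolution and the Fourier transform in `t` together make `√w_λ(ζ) B_λ f^λ(ζ)` the integral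
of `f` over the Heisenberg group against one explicit kernel. The modulus of this kernel is a
Gaussian in a completed square, so it is at most `c_λ (1 + λ²)ⁿ`, uniformly in `ζ`.

The kernel is an exponential of a quadratic polynomial, so integration by parts turns `∂_t f` into
multiplication of the transform by `-iλ`, which gives every power of `(1 + λ²)⁻¹`. Along the
coordinates of `ℝ²ⁿ` it expresses `(cosh (λ/2) - sinh (λ/2) iJ) ζ` times the transform, `J` being
the complex structure of the symplectic form, through the transforms of `∂ᵢ f` and `ξᵢ f`. Since
`iJ` is an isometric involution, that operator is `exp (-(λ/2) iJ)`, with inverse of norm at most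
`e^{|λ|/2}`. As the coefficients of `∂ᵢ f` and `ξᵢ f` are at most `e^{|λ|/2}` as well, each factor
`|ζ|` costs `e^{|λ|}`.
-/

namespace TwistedBargmann

open MeasureTheory LineDeriv
open scoped InnerProductSpace

/-! ### Hyperbolic functions -/

theorem cosh_add_abs_sinh (x : ℝ) : Real.cosh x + |Real.sinh x| = Real.exp |x| := by
  rw [Real.abs_sinh, ← Real.cosh_abs, Real.cosh_add_sinh]

theorem cosh_le_exp_abs (x : ℝ) : Real.cosh x ≤ Real.exp |x| := by
  linarith [cosh_add_abs_sinh x, abs_nonneg (Real.sinh x)]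

theorem abs_sinh_le_abs_mul_exp (x : ℝ) : |Real.sinh x| ≤ |x| * Real.exp |x| := by
  have tangent : Real.exp |x| * (-(2 * |x|) + 1) ≤ Real.exp (-|x|) := by
    calc _ ≤ Real.exp |x| * Real.exp (-(2 * |x|)) := by gcongr; exact Real.add_one_le_exp _
      _ = Real.exp (-|x|) := by rw [← Real.exp_add]; ring_nf
  rw [Real.abs_sinh, Real.sinh_eq]
  linarith

theorem abs_sinh_div_self_le_exp_abs (x : ℝ) : |Real.sinh x / x| ≤ Real.exp |x| := by
  rw [abs_div]
  exact div_le_of_le_mul₀ (abs_nonneg x) (Real.exp_nonneg _)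
    (by linarith [abs_sinh_le_abs_mul_exp x])

theorem mul_coth_abs (x : ℝ) : |x| * coth |x| = x * coth x := by
  rw [coth, coth, Real.cosh_abs, ← Real.abs_sinh]
  rcases abs_cases x with ⟨hx, h0⟩ | ⟨hx, h0⟩
  · rw [hx, abs_of_nonneg (Real.sinh_nonneg_iff.2 h0)]
  · rw [hx, abs_of_neg (Real.sinh_neg_iff.2 h0), div_neg, neg_mul_neg]

theorem mul_coth_le_one_add_abs (x : ℝ) : x * coth x ≤ 1 + |x| := by
  rw [← mul_coth_abs, coth, ← mul_div_assoc]
  set y := |x|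
  have hy : 0 ≤ y := abs_nonneg x
  have hy_sinh : y ≤ Real.sinh y := Real.self_le_sinh_iff.2 hy
  have hcosh : Real.cosh y ≤ Real.sinh y + 1 := by
    linarith [Real.cosh_sub_sinh y, Real.exp_le_one_iff.2 (neg_nonpos.2 hy)]
  refine div_le_of_le_mul₀ (hy.trans hy_sinh) (by positivity) ?_
  linarith [mul_le_mul_of_nonneg_left hcosh hy]

theorem mul_coth_pos {x : ℝ} (hx : x ≠ 0) : 0 < x * coth x := by
  rw [← mul_coth_abs]
  have hsinh := Real.sinh_pos_iff.2 (abs_pos.2 hx)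
  exact mul_pos (abs_pos.2 hx) (div_pos (Real.cosh_pos _) hsinh)

theorem coth_two_mul {x : ℝ} (hx : x ≠ 0) : coth (2 * x) = (coth x + (coth x)⁻¹) / 2 := by
  have hs := Real.sinh_ne_zero.2 hx
  have hc := (Real.cosh_pos x).ne'
  rw [coth, coth, Real.cosh_two_mul, Real.sinh_two_mul]
  field_simp

theorem div_sinh_mul_pos {t x : ℝ} (ht : 0 < t) (hx : x ≠ 0) : 0 < x / Real.sinh (t * x) := by
  rcases hx.lt_or_gt with h | h
  · exact div_pos_of_neg_of_neg h (Real.sinh_neg_iff.2 (mul_neg_of_pos_of_neg ht h))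
  · exact div_pos h (Real.sinh_pos_iff.2 (mul_pos ht h))

/-! ### The symplectic form and its complex structure -/

variable {n : ℕ}

/-- The complex structure `J(z, w) = (w, -z)` belonging to the symplectic form, which is
`[ζ, ζ'] = Jζ · ζ'` in terms of the bilinear dot product. -/
noncomputable def sympRot (𝕜 : Type*) [RCLike 𝕜] :
    EuclideanSpace 𝕜 (Fin n ⊕ Fin n) →ₗᵢ[𝕜] EuclideanSpace 𝕜 (Fin n ⊕ Fin n) where
  toFun ζ := WithLp.toLp 2 (Sum.elim (fun j => ζ (.inr j)) fun j => -ζ (.inl j))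
  map_add' ζ ζ' := by ext (j | j) <;> simp [add_comm]
  map_smul' c ζ := by ext (j | j) <;> simp
  norm_map' ζ := by simp [EuclideanSpace.norm_eq, add_comm]

@[simp]
theorem sympRot_inl {𝕜 : Type*} [RCLike 𝕜] (ζ : EuclideanSpace 𝕜 (Fin n ⊕ Fin n)) (j : Fin n) :
    sympRot 𝕜 ζ (.inl j) = ζ (.inr j) := rfl

@[simp]
theorem sympRot_inr {𝕜 : Type*} [RCLike 𝕜] (ζ : EuclideanSpace 𝕜 (Fin n ⊕ Fin n)) (j : Fin n) :
    sympRot 𝕜 ζ (.inr j) = -ζ (.inl j) := rfl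

theorem sympRot_sympRot {𝕜 : Type*} [RCLike 𝕜] (ζ : EuclideanSpace 𝕜 (Fin n ⊕ Fin n)) :
    sympRot 𝕜 (sympRot 𝕜 ζ) = -ζ := by
  ext (j | j) <;> simp

theorem sympC_eq_sum_sympRot (ζ ζ' : C2 n) : sympC ζ ζ' = ∑ i, sympRot ℂ ζ i * ζ' i := by
  simp only [sympC, Fintype.sum_sum_type, sympRot_inl, sympRot_inr, ← Finset.sum_add_distrib]
  exact Finset.sum_congr rfl fun j _ => by ring

theorem symp_eq_inner_sympRot (ξ η : R2 n) : symp ξ η = ⟪sympRot ℝ ξ, η⟫_ℝ := by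
  simp only [symp, PiLp.inner_apply, Fintype.sum_sum_type, sympRot_inl, sympRot_inr,
    ← Finset.sum_add_distrib]
  exact Finset.sum_congr rfl fun j _ => by simp; ring

theorem symp_swap (ξ η : R2 n) : symp ξ η = -symp η ξ := by
  simp only [symp, ← Finset.sum_neg_distrib, neg_sub]

theorem im_sympC_toC (ζ : C2 n) (η : R2 n) : (sympC ζ (toC η)).im = symp (imPart ζ) η := by
  simp [sympC, symp, toC, imPart]

theorem norm_sq_eq_rePart_add_imPart (ζ : C2 n) :
    ‖ζ‖ ^ 2 = ‖rePart ζ‖ ^ 2 + ‖imPart ζ‖ ^ 2 := by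
  simp only [EuclideanSpace.norm_sq_eq, ← Finset.sum_add_distrib]
  refine Finset.sum_congr rfl fun i _ => ?_
  simp only [rePart, imPart, Real.norm_eq_abs, sq_abs, Complex.sq_norm, Complex.normSq_apply]
  ring

theorem re_sum_sq_eq_rePart_sub_imPart (ζ : C2 n) :
    (∑ i, ζ i ^ 2).re = ‖rePart ζ‖ ^ 2 - ‖imPart ζ‖ ^ 2 := by
  simp only [EuclideanSpace.norm_sq_eq, ← Finset.sum_sub_distrib, Complex.re_sum]
  refine Finset.sum_congr rfl fun i _ => ?_
  simp [rePart, imPart, sq]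

theorem rePart_sub_toC (ζ : C2 n) (η : R2 n) : rePart (ζ - toC η) = rePart ζ - η := by
  ext i; simp [rePart, toC]

theorem imPart_sub_toC (ζ : C2 n) (η : R2 n) : imPart (ζ - toC η) = imPart ζ := by
  ext i; simp [imPart, toC]

/-! ### Gaussian bounds -/

/-- The value `p_t^λ(0)` of the special Hermite heat kernel. -/
noncomputable def heatConst (n : ℕ) (t lam : ℝ) : ℝ :=
  ((4 * Real.pi) ^ n)⁻¹ * lam ^ n * (Real.sinh (t * lam) ^ n)⁻¹

theorem heatConst_one (n : ℕ) (lam : ℝ) : heatConst n 1 lam = cConst n lam := by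
  rw [heatConst, cConst, one_mul]

theorem heatConst_pos (n : ℕ) {t lam : ℝ} (ht : 0 < t) (hlam : lam ≠ 0) :
    0 < heatConst n t lam := by
  have hpos := div_sinh_mul_pos ht hlam
  have : heatConst n t lam = ((4 * Real.pi) ^ n)⁻¹ * (lam / Real.sinh (t * lam)) ^ n := by
    rw [heatConst, div_pow, mul_assoc, ← div_eq_mul_inv]
  rw [this]
  positivity

theorem cConst_pos (n : ℕ) {lam : ℝ} (hlam : lam ≠ 0) : 0 < cConst n lam :=
  heatConst_one n lam ▸ heatConst_pos n one_pos hlam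

theorem heatConst_sq (n : ℕ) {t lam : ℝ} (h : t * lam ≠ 0) :
    heatConst n t lam ^ 2
      = heatConst n (2 * t) lam * (lam * coth (t * lam) / (2 * Real.pi)) ^ n := by
  have hsinh := Real.sinh_ne_zero.2 h
  rw [heatConst, heatConst, mul_assoc 2, Real.sinh_two_mul, coth]
  simp only [← inv_pow, ← mul_pow]
  rw [← pow_mul, mul_comm n 2, pow_mul]
  congr 1
  field_simp [hsinh]
  ring

theorem heatConst_half_sq_le (n : ℕ) {lam : ℝ} (hlam : lam ≠ 0) :
    heatConst n (1 / 2) lam ^ 2 ≤ cConst n lam * (1 + lam ^ 2) ^ n := by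
  have hhalf : 1 / 2 * lam ≠ 0 := by simpa using hlam
  have hcoth : lam * coth (1 / 2 * lam) ≤ 2 * Real.pi * (1 + lam ^ 2) := by
    have habs : |1 / 2 * lam| ≤ 1 + lam ^ 2 := by
      rw [abs_mul, ← sq_abs lam, abs_of_pos one_half_pos]
      nlinarith [sq_nonneg (|lam| - 1)]
    nlinarith [mul_coth_le_one_add_abs (1 / 2 * lam), Real.pi_gt_three, sq_nonneg lam]
  have hcoth_pos : 0 < lam * coth (1 / 2 * lam) := by linarith [mul_coth_pos hhalf]
  rw [heatConst_sq n hhalf, mul_one_div_cancel two_ne_zero, heatConst_one]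
  gcongr
  · exact (cConst_pos n hlam).le
  · exact div_le_of_le_mul₀ (by positivity) (by positivity) (by linarith)

theorem sqrt_cConst_mul_heatConst_half_le (n : ℕ) {lam : ℝ} (hlam : lam ≠ 0) :
    √(cConst n lam) * heatConst n (1 / 2) lam ≤ cConst n lam * (1 + lam ^ 2) ^ n := by
  have hc := (cConst_pos n hlam).le
  have hone : (1 : ℝ) ≤ (1 + lam ^ 2) ^ n := one_le_pow₀ (by linarith [sq_nonneg lam])
  refine le_of_sq_le_sq ?_ (by positivity)
  calc (√(cConst n lam) * heatConst n (1 / 2) lam) ^ 2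
      = cConst n lam * heatConst n (1 / 2) lam ^ 2 := by rw [mul_pow, Real.sq_sqrt hc]
    _ ≤ cConst n lam * (cConst n lam * (1 + lam ^ 2) ^ n) := by
      gcongr; exact heatConst_half_sq_le n hlam
    _ ≤ cConst n lam * (cConst n lam * (1 + lam ^ 2) ^ n) * (1 + lam ^ 2) ^ n :=
      le_mul_of_one_le_right (by positivity) hone
    _ = (cConst n lam * (1 + lam ^ 2) ^ n) ^ 2 := by ring

theorem norm_heatKernel {t lam : ℝ} (ht : 0 < t) (hlam : lam ≠ 0) (ζ : C2 n) :
    ‖heatKernel n t lam ζ‖ = heatConst n t lam *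
      Real.exp (-(1 / 4) * lam * coth (t * lam) * (‖rePart ζ‖ ^ 2 - ‖imPart ζ‖ ^ 2)) := by
  have hreal : (-(1 / 4) * (lam : ℂ) * (coth (t * lam) : ℂ))
      = ((-(1 / 4) * lam * coth (t * lam) : ℝ) : ℂ) := by push_cast; ring
  rw [heatKernel, ← heatConst, norm_mul, Complex.norm_exp, Complex.norm_real,
    Real.norm_of_nonneg (heatConst_pos n ht hlam).le, hreal, Complex.re_ofReal_mul,
    re_sum_sq_eq_rePart_sub_imPart]

theorem norm_exp_twist (lam : ℝ) (ζ : C2 n) (η : R2 n) :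
    ‖Complex.exp (-Complex.I * ((lam : ℂ) / 2) * sympC ζ (toC η))‖
      = Real.exp (1 / 2 * lam * symp (imPart ζ) η) := by
  have hreal : -Complex.I * ((lam : ℂ) / 2) * sympC ζ (toC η)
      = ((1 / 2 * lam : ℝ) : ℂ) * (-Complex.I * sympC ζ (toC η)) := by push_cast; ring
  rw [Complex.norm_exp, hreal, Complex.re_ofReal_mul, ← im_sympC_toC]
  simp

theorem sqrt_weight {lam : ℝ} (hlam : lam ≠ 0) (ζ : C2 n) :
    √(weight lam ζ) = √(cConst n lam) * Real.exp
      (-(1 / 4) * lam * coth lam * ‖ζ‖ ^ 2 + 1 / 2 * lam * symp (rePart ζ) (imPart ζ)) := by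
  rw [weight, mul_assoc, Real.sqrt_mul (cConst_pos n hlam).le, ← Real.exp_add, ← Real.exp_half]
  ring_nf

/-! ### The weighted transform as an integral operator -/

/-- The kernel whose integral against `f` over the Heisenberg group is `√w_λ(ζ) B_λ f^λ(ζ)`. -/
noncomputable def weightedKernel (lam : ℝ) (ζ : C2 n) (p : Heis n) : ℂ :=
  √(weight lam ζ) * (cConst n lam * (heatKernel n 1 lam ζ)⁻¹) *
    (heatKernel n (1 / 2) lam (ζ - toC p.1) *
      Complex.exp (-Complex.I * ((lam : ℂ) / 2) * sympC ζ (toC p.1)) *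
      Complex.exp (Complex.I * (lam : ℂ) * (p.2 : ℂ)))

/-- The pairing of `f` with `weightedKernel`, which is `√w_λ(ζ) B_λ f^λ(ζ)`. -/
noncomputable def weightedBargmann (lam : ℝ) (ζ : C2 n) (f : Heis n → ℂ) : ℂ :=
  ∫ p, f p * weightedKernel lam ζ p

-- The left side collects the exponents of `√w_λ`, `1 / |p_1^λ|`, `|p_{1/2}^λ|` and the twist at
-- `ζ = ξ + iy`; it is a perfect square because `2 coth λ = coth (λ/2) + tanh (λ/2)`.
theorem gaussian_exponent_eq {lam : ℝ} (hlam : lam ≠ 0) (ξ y η : R2 n) :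
    -(1 / 4) * lam * coth lam * (‖ξ‖ ^ 2 + ‖y‖ ^ 2) + 1 / 2 * lam * symp ξ y
        + 1 / 4 * lam * coth lam * (‖ξ‖ ^ 2 - ‖y‖ ^ 2)
        - 1 / 4 * lam * coth (1 / 2 * lam) * (‖ξ - η‖ ^ 2 - ‖y‖ ^ 2) + 1 / 2 * lam * symp y η
      = -(lam / (4 * coth (1 / 2 * lam)) *
          ‖coth (1 / 2 * lam) • (ξ - η) + sympRot ℝ y‖ ^ 2) := by
  have hhalf : 1 / 2 * lam ≠ 0 := by simpa using hlam
  have hcoth : coth lam = (coth (1 / 2 * lam) + (coth (1 / 2 * lam))⁻¹) / 2 := by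
    rw [← coth_two_mul hhalf]; ring_nf
  have hb : coth (1 / 2 * lam) ≠ 0 := right_ne_zero_of_mul (mul_coth_pos hhalf).ne'
  rw [norm_add_sq_real, norm_smul, LinearIsometry.norm_map, inner_smul_left, inner_sub_left,
    real_inner_comm _ ξ, real_inner_comm _ η, ← symp_eq_inner_sympRot, ← symp_eq_inner_sympRot,
    symp_swap ξ y, hcoth, mul_pow, Real.norm_eq_abs, sq_abs, conj_trivial]
  generalize coth (1 / 2 * lam) = b at hb
  field_simp
  ring

theorem norm_weightedKernel {lam : ℝ} (hlam : lam ≠ 0) (ζ : C2 n) (p : Heis n) :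
    ‖weightedKernel lam ζ p‖ = √(cConst n lam) * heatConst n (1 / 2) lam *
      Real.exp (-(lam / (4 * coth (1 / 2 * lam)) *
        ‖coth (1 / 2 * lam) • (rePart ζ - p.1) + sympRot ℝ (imPart ζ)‖ ^ 2)) := by
  have hc := cConst_pos n hlam
  have hcentral : ‖Complex.exp (Complex.I * (lam : ℂ) * (p.2 : ℂ))‖ = 1 := by
    simp [Complex.norm_exp]
  rw [← gaussian_exponent_eq hlam, weightedKernel]
  simp only [norm_mul, norm_inv, Complex.norm_real, Real.norm_of_nonneg hc.le,
    Real.norm_of_nonneg (Real.sqrt_nonneg _), Real.norm_of_nonneg (Real.exp_nonneg _),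
    norm_heatKernel one_pos hlam, norm_heatKernel one_half_pos hlam, norm_exp_twist, hcentral,
    sqrt_weight hlam, rePart_sub_toC, imPart_sub_toC, heatConst_one, one_mul, mul_one]
  rw [mul_inv, mul_inv_cancel_left₀ hc.ne', ← Real.exp_neg]
  simp only [sub_eq_add_neg, Real.exp_add, ← norm_sq_eq_rePart_add_imPart, mul_assoc, neg_mul,
    neg_neg]
  ring

theorem norm_weightedKernel_le {lam : ℝ} (hlam : lam ≠ 0) (ζ : C2 n) (p : Heis n) :
    ‖weightedKernel lam ζ p‖ ≤ cConst n lam * (1 + lam ^ 2) ^ n := by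
  have hratio : 0 ≤ lam / (4 * coth (1 / 2 * lam)) := by
    have hpos := mul_coth_pos (x := 1 / 2 * lam) (by simpa using hlam)
    have : lam / (4 * coth (1 / 2 * lam))
        = 1 / 2 * lam * coth (1 / 2 * lam) * (2 * (coth (1 / 2 * lam) ^ 2)⁻¹ / 4) := by
      field_simp [right_ne_zero_of_mul hpos.ne']
    rw [this]; positivity
  rw [norm_weightedKernel hlam]
  refine le_trans (mul_le_of_le_one_right ?_ ?_) (sqrt_cConst_mul_heatConst_half_le n hlam)
  · exact mul_nonneg (Real.sqrt_nonneg _) (heatConst_pos n one_half_pos hlam).le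
  · exact Real.exp_le_one_iff.2 (neg_nonpos.2 (by positivity))

/-- The logarithm of `weightedKernel`, up to an additive constant. -/
noncomputable def kernelPhase (lam : ℝ) (ζ : C2 n) (p : Heis n) : ℂ :=
  ∑ i, (-(lam / 4 * coth (1 / 2 * lam)) * (ζ i - p.1 i) ^ 2
      - Complex.I * (lam / 2) * sympRot ℂ ζ i * p.1 i) +
    Complex.I * lam * p.2

theorem exists_weightedKernel_eq (lam : ℝ) (ζ : C2 n) :
    ∃ A : ℂ, weightedKernel lam ζ = fun p => A * Complex.exp (kernelPhase lam ζ p) := by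
  refine ⟨√(weight lam ζ) * (cConst n lam * (heatKernel n 1 lam ζ)⁻¹) *
    heatConst n (1 / 2) lam, funext fun p => ?_⟩
  have hhalf : heatKernel n (1 / 2) lam (ζ - toC p.1) = heatConst n (1 / 2) lam *
      Complex.exp (-(1 / 4) * lam * coth (1 / 2 * lam) * ∑ i, (ζ - toC p.1) i ^ 2) := rfl
  rw [weightedKernel, hhalf, mul_assoc (heatConst n (1 / 2) lam : ℂ), ← Complex.exp_add,
    mul_assoc (heatConst n (1 / 2) lam : ℂ), ← Complex.exp_add, ← mul_assoc,
    kernelPhase, Finset.sum_sub_distrib, sympC_eq_sum_sympRot]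
  simp only [mul_assoc, ← Finset.mul_sum, toC, PiLp.sub_apply]
  ring_nf

theorem continuous_weightedKernel (lam : ℝ) (ζ : C2 n) : Continuous (weightedKernel lam ζ) := by
  obtain ⟨A, hA⟩ := exists_weightedKernel_eq lam ζ
  rw [hA]
  unfold kernelPhase
  fun_prop

section Integrable

variable {lam : ℝ} (hlam : lam ≠ 0) (ζ : C2 n) {f : Heis n → ℂ} (hf : Integrable f)
include hlam hf

theorem integrable_mul_weightedKernel : Integrable fun p => f p * weightedKernel lam ζ p :=
  hf.mul_bdd (continuous_weightedKernel lam ζ).aestronglyMeasurable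
    (.of_forall (norm_weightedKernel_le hlam ζ))

theorem norm_weightedBargmann_le :
    ‖weightedBargmann lam ζ f‖ ≤ (∫ p, ‖f p‖) * (cConst n lam * (1 + lam ^ 2) ^ n) := by
  rw [← integral_mul_const]
  refine norm_integral_le_of_norm_le (hf.norm.mul_const _) (.of_forall fun p => ?_)
  rw [norm_mul]
  gcongr
  exact norm_weightedKernel_le hlam ζ p

theorem weightedBargmann_eq :
    weightedBargmann lam ζ f = √(weight lam ζ) * bargmann lam (centralFourier f lam) ζ := by
  have hint := integrable_mul_weightedKernel hlam ζ hf
  rw [Measure.volume_eq_prod] at hint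
  rw [weightedBargmann, Measure.volume_eq_prod, integral_prod _ hint, bargmann, twistedConv,
    ← mul_assoc, ← integral_const_mul]
  refine integral_congr_ae (.of_forall fun η => ?_)
  simp only [centralFourier]
  rw [mul_assoc (∫ t, _), ← integral_mul_const, ← integral_const_mul]
  refine integral_congr_ae (.of_forall fun t => ?_)
  simp only [weightedKernel]
  ring

end Integrable

/-! ### Integration by parts -/

theorem integral_lineDeriv_mul_eq_neg {E : Type*} [NormedAddCommGroup E] [NormedSpace ℝ E]
    [FiniteDimensional ℝ E] [MeasurableSpace E] [BorelSpace E] {μ : Measure E}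
    [μ.IsAddHaarMeasure] {v : E} {f g : 𝓢(E, ℂ)} {k α : E → ℂ}
    (hk : ∀ p, HasLineDerivAt ℝ k (α p * k p) p v) (hg : ∀ p, g p = α p * f p)
    (hint : ∀ h : 𝓢(E, ℂ), Integrable (fun p => h p * k p) μ) :
    ∫ p, (∂_{v} f : 𝓢(E, ℂ)) p * k p ∂μ = -∫ p, g p * k p ∂μ := by
  have hgk : ∀ p, f p * (α p * k p) = g p * k p := fun p => by rw [hg]; ring
  have hparts := integral_bilinear_hasLineDerivAt_right_eq_neg_left_of_integrable
    (μ := μ) (f := f) (f' := (∂_{v} f : 𝓢(E, ℂ))) (g := k) (g' := fun p => α p * k p) (v := v)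
    (B := ContinuousLinearMap.mul ℝ ℂ) (hint _)
    (by simpa only [ContinuousLinearMap.mul_apply', hgk] using hint g) (hint f)
    (fun p _ => by
      rw [SchwartzMap.lineDerivOp_apply_eq_fderiv]
      exact f.differentiableAt.hasFDerivAt.hasLineDerivAt v)
    (fun p _ => hk p)
  simp only [ContinuousLinearMap.mul_apply', hgk] at hparts
  rw [hparts, neg_neg]

theorem hasDerivAt_ofReal_add_mul (a v : ℝ) :
    HasDerivAt (fun t : ℝ => ((a + t * v : ℝ) : ℂ)) (v : ℂ) 0 := by
  simpa using (((hasDerivAt_id (0 : ℝ)).mul_const v).const_add a).ofReal_comp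

theorem hasLineDerivAt_kernelPhase (lam : ℝ) (ζ : C2 n) (p v : Heis n) :
    HasLineDerivAt ℝ (kernelPhase lam ζ)
      (∑ i, (lam / 2 * coth (1 / 2 * lam) * (ζ i - p.1 i)
        - Complex.I * (lam / 2) * sympRot ℂ ζ i) * v.1 i + Complex.I * lam * v.2) p v := by
  unfold HasLineDerivAt kernelPhase
  refine (HasDerivAt.fun_sum fun i _ => ?_).add
    ((hasDerivAt_ofReal_add_mul p.2 v.2).const_mul _)
  have hcoord := hasDerivAt_ofReal_add_mul (p.1 i) (v.1 i)
  refine ((((hcoord.const_sub (ζ i)).fun_pow 2).const_mul _).sub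
    (hcoord.const_mul _)).congr_deriv ?_
  push_cast
  simp only [zero_mul, add_zero]
  ring

theorem hasLineDerivAt_weightedKernel (lam : ℝ) (ζ : C2 n) (p v : Heis n) :
    HasLineDerivAt ℝ (weightedKernel lam ζ)
      ((∑ i, (lam / 2 * coth (1 / 2 * lam) * (ζ i - p.1 i)
        - Complex.I * (lam / 2) * sympRot ℂ ζ i) * v.1 i + Complex.I * lam * v.2) *
        weightedKernel lam ζ p) p v := by
  obtain ⟨A, hA⟩ := exists_weightedKernel_eq lam ζ
  have hphase := hasLineDerivAt_kernelPhase lam ζ p v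
  rw [hA]
  unfold HasLineDerivAt at hphase ⊢
  refine (hphase.cexp.const_mul A).congr_deriv ?_
  simp only [zero_smul, add_zero]
  ring

/-- Multiplication by the `i`-th coordinate of `ℝ²ⁿ`, as an operation on Schwartz functions. -/
noncomputable def coordMul (i : Fin n ⊕ Fin n) (f : 𝓢(Heis n, ℂ)) : 𝓢(Heis n, ℂ) :=
  SchwartzMap.smulLeftCLM ℂ (fun p : Heis n => p.1 i) f

theorem coordMul_apply (i : Fin n ⊕ Fin n) (f : 𝓢(Heis n, ℂ)) (p : Heis n) :
    coordMul i f p = p.1 i * f p := by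
  rw [coordMul, SchwartzMap.smulLeftCLM_apply_apply, Complex.real_smul]
  exact ((EuclideanSpace.proj i : R2 n →L[ℝ] ℝ).comp
    (ContinuousLinearMap.fst ℝ (R2 n) ℝ)).hasTemperateGrowth

/-- The partial derivative along the `i`-th coordinate of `ℝ²ⁿ`. -/
noncomputable def coordDeriv (i : Fin n ⊕ Fin n) (f : 𝓢(Heis n, ℂ)) : 𝓢(Heis n, ℂ) :=
  ∂_{((EuclideanSpace.single i 1, 0) : Heis n)} f

/-- The partial derivative along the central variable. -/
noncomputable def centralDeriv (f : 𝓢(Heis n, ℂ)) : 𝓢(Heis n, ℂ) :=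
  ∂_{((0, 1) : Heis n)} f

instance isAddHaarMeasure_volume_heis (n : ℕ) :
    (volume : Measure (Heis n)).IsAddHaarMeasure :=
  inferInstanceAs ((volume : Measure (R2 n)).prod (volume : Measure ℝ)).IsAddHaarMeasure

section Schwartz

variable {lam : ℝ} (hlam : lam ≠ 0) (ζ : C2 n) (f : 𝓢(Heis n, ℂ))
include hlam

theorem weightedBargmann_centralDeriv :
    weightedBargmann lam ζ (centralDeriv f) = -(Complex.I * lam * weightedBargmann lam ζ f) := by
  have hparts := integral_lineDeriv_mul_eq_neg (μ := volume) (f := f)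
    (g := (Complex.I * lam) • f) (α := fun _ => Complex.I * lam) (v := ((0, 1) : Heis n))
    (fun p => by simpa using hasLineDerivAt_weightedKernel lam ζ p (0, 1)) (fun _ => rfl)
    fun h => integrable_mul_weightedKernel hlam ζ h.integrable
  rw [weightedBargmann, centralDeriv, hparts, weightedBargmann, ← integral_const_mul]
  simp only [smul_apply, smul_eq_mul, mul_assoc]

theorem weightedBargmann_coordDeriv (i : Fin n ⊕ Fin n) :
    weightedBargmann lam ζ (coordDeriv i f) =
      lam / 2 * coth (1 / 2 * lam) * weightedBargmann lam ζ (coordMul i f)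
        - (lam / 2 * coth (1 / 2 * lam) * ζ i - Complex.I * (lam / 2) * sympRot ℂ ζ i) *
          weightedBargmann lam ζ f := by
  set β : ℂ := lam / 2 * coth (1 / 2 * lam)
  set γ : ℂ := β * ζ i - Complex.I * (lam / 2) * sympRot ℂ ζ i
  have hint := fun h : 𝓢(Heis n, ℂ) => integrable_mul_weightedKernel hlam ζ h.integrable
  have hparts := integral_lineDeriv_mul_eq_neg (μ := volume) (f := f)
    (g := γ • f - β • coordMul i f) (α := fun p => γ - β * p.1 i)
    (v := ((EuclideanSpace.single i 1, 0) : Heis n))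
    (fun p => (hasLineDerivAt_weightedKernel lam ζ p _).congr_deriv <| congrArg (· * _) <| by
      simp [-Fintype.sum_sum_type, apply_ite Complex.ofReal, β, γ]; ring)
    (fun p => by simp [coordMul_apply]; ring) hint
  rw [weightedBargmann, coordDeriv, hparts, weightedBargmann, weightedBargmann,
    ← integral_const_mul, ← integral_const_mul, ← integral_sub ((hint _).const_mul _)
    ((hint _).const_mul _), ← integral_neg]
  congr 1 with p
  simp only [sub_apply, smul_apply, smul_eq_mul]
  ring

theorem sq_mul_norm_weightedBargmann :
    lam ^ 2 * ‖weightedBargmann lam ζ f‖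
      = ‖weightedBargmann lam ζ (centralDeriv (centralDeriv f))‖ := by
  rw [weightedBargmann_centralDeriv hlam, weightedBargmann_centralDeriv hlam]
  simp [← mul_assoc, ← sq]

end Schwartz

/-! ### Inverting the first-order relation -/

theorem norm_le_exp_abs_mul_norm_cosh_smul_sub {E : Type*} [NormedAddCommGroup E]
    [NormedSpace ℂ E] (J : E →ₗᵢ[ℂ] E) (hJ : ∀ v, J (J v) = -v) (x : ℝ) (v : E) :
    ‖v‖ ≤ Real.exp |x| *
      ‖(Real.cosh x : ℂ) • v - (Complex.I * (Real.sinh x : ℂ)) • J v‖ := by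
  set u := (Real.cosh x : ℂ) • v - (Complex.I * (Real.sinh x : ℂ)) • J v with hu
  have hv : v = (Real.cosh x : ℂ) • u + (Complex.I * (Real.sinh x : ℂ)) • J u := by
    rw [hu, map_sub, map_smul, map_smul, hJ]
    match_scalars
    · linear_combination -Complex.cosh_sq_sub_sinh_sq x - Complex.sinh x ^ 2 * Complex.I_sq
    · ring
  calc ‖v‖ ≤ ‖(Real.cosh x : ℂ) • u‖ + ‖(Complex.I * (Real.sinh x : ℂ)) • J u‖ :=
        (congrArg norm hv).trans_le (norm_add_le _ _)
    _ = (Real.cosh x + |Real.sinh x|) * ‖u‖ := by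
        rw [norm_smul, norm_smul, norm_mul, Complex.norm_I, J.norm_map, Complex.norm_real,
          Complex.norm_real, Real.norm_of_nonneg (Real.cosh_pos x).le, Real.norm_eq_abs]
        ring
    _ = Real.exp |x| * ‖u‖ := by rw [cosh_add_abs_sinh]

theorem norm_le_sum_norm_apply {𝕜 ι : Type*} [RCLike 𝕜] [Fintype ι] (v : EuclideanSpace 𝕜 ι) :
    ‖v‖ ≤ ∑ i, ‖v i‖ := by
  rw [EuclideanSpace.norm_eq]
  exact Real.sqrt_le_iff.2 ⟨Finset.sum_nonneg fun i _ => norm_nonneg _,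
    Finset.sum_sq_le_sq_sum_of_nonneg fun i _ => norm_nonneg _⟩

theorem weightedBargmann_mul_cosh_sub_sinh {lam : ℝ} (hlam : lam ≠ 0) (ζ : C2 n)
    (f : 𝓢(Heis n, ℂ)) (i : Fin n ⊕ Fin n) :
    weightedBargmann lam ζ f * ((Real.cosh (1 / 2 * lam) : ℂ) • ζ -
        (Complex.I * (Real.sinh (1 / 2 * lam) : ℂ)) • sympRot ℂ ζ) i
      = Real.cosh (1 / 2 * lam) * weightedBargmann lam ζ (coordMul i f)
        - (Real.sinh (1 / 2 * lam) / (1 / 2 * lam) : ℝ) *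
          weightedBargmann lam ζ (coordDeriv i f) := by
  have hhalf : 1 / 2 * lam ≠ 0 := by simpa using hlam
  have hlamC : (lam : ℂ) / 2 = (1 / 2 * lam : ℝ) := by push_cast; ring
  rw [weightedBargmann_coordDeriv hlam, coth, Complex.ofReal_div, Complex.ofReal_div, hlamC]
  simp only [PiLp.sub_apply, PiLp.smul_apply, smul_eq_mul]
  generalize 1 / 2 * lam = x at hhalf
  have hx : (x : ℂ) ≠ 0 := Complex.ofReal_ne_zero.2 hhalf
  have hsinh : (Real.sinh x : ℂ) ≠ 0 := Complex.ofReal_ne_zero.2 (Real.sinh_ne_zero.2 hhalf)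
  field_simp
  ring

theorem norm_mul_norm_weightedBargmann_le {lam : ℝ} (hlam : lam ≠ 0) (ζ : C2 n)
    (f : 𝓢(Heis n, ℂ)) :
    ‖ζ‖ * ‖weightedBargmann lam ζ f‖ ≤ Real.exp |lam| *
      ∑ i, (‖weightedBargmann lam ζ (coordMul i f)‖ +
        ‖weightedBargmann lam ζ (coordDeriv i f)‖) := by
  set u : C2 n := (Real.cosh (1 / 2 * lam) : ℂ) • ζ -
    (Complex.I * (Real.sinh (1 / 2 * lam) : ℂ)) • sympRot ℂ ζ with hu
  have hcoord (i) : ‖u i‖ * ‖weightedBargmann lam ζ f‖ ≤ Real.exp |1 / 2 * lam| *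
      (‖weightedBargmann lam ζ (coordMul i f)‖ + ‖weightedBargmann lam ζ (coordDeriv i f)‖) := by
    rw [mul_comm, ← norm_mul, hu, weightedBargmann_mul_cosh_sub_sinh hlam, mul_add]
    refine (norm_sub_le _ _).trans (add_le_add ?_ ?_)
    · rw [norm_mul, Complex.norm_real, Real.norm_of_nonneg (Real.cosh_pos _).le]
      gcongr
      exact cosh_le_exp_abs _
    · rw [norm_mul, Complex.norm_real, Real.norm_eq_abs]
      gcongr
      exact abs_sinh_div_self_le_exp_abs _
  have hexp : Real.exp |lam| = Real.exp |1 / 2 * lam| * Real.exp |1 / 2 * lam| := by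
    rw [← Real.exp_add, abs_mul, abs_of_pos (one_half_pos (α := ℝ))]
    ring_nf
  calc ‖ζ‖ * ‖weightedBargmann lam ζ f‖
      ≤ Real.exp |1 / 2 * lam| * ‖u‖ * ‖weightedBargmann lam ζ f‖ := by
        gcongr
        exact norm_le_exp_abs_mul_norm_cosh_smul_sub (sympRot ℂ) sympRot_sympRot _ ζ
    _ ≤ Real.exp |1 / 2 * lam| * (∑ i, ‖u i‖) * ‖weightedBargmann lam ζ f‖ := by
        gcongr
        exact norm_le_sum_norm_apply u
    _ = Real.exp |1 / 2 * lam| * ∑ i, ‖u i‖ * ‖weightedBargmann lam ζ f‖ := by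
        rw [mul_assoc, Finset.sum_mul]
    _ ≤ _ := by
        rw [hexp, mul_assoc]
        gcongr
        rw [Finset.mul_sum]
        exact Finset.sum_le_sum fun i _ => hcoord i

/-! ### Iteration -/

theorem exists_one_add_pow_mul_le {S X ι : Type*} [Fintype ι] {T : X → S → ℝ} {b W : S → ℝ}
    (hb : ∀ s, 0 ≤ b s) {L : ι → X → X} (hL : ∀ f s, b s * T f s ≤ ∑ i, T (L i f) s)
    (hT : ∀ f, ∃ C, ∀ s, T f s ≤ C * W s) (k : ℕ) (f : X) :
    ∃ C, ∀ s, (1 + b s) ^ k * T f s ≤ C * W s := by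
  induction k generalizing f with
  | zero => simpa using hT f
  | succ k ih =>
    choose C hC using ih
    refine ⟨C f + ∑ i, C (L i f), fun s => ?_⟩
    have hpow : 0 ≤ (1 + b s) ^ k := pow_nonneg (by linarith [hb s]) k
    calc (1 + b s) ^ (k + 1) * T f s
        = (1 + b s) ^ k * T f s + (1 + b s) ^ k * (b s * T f s) := by ring
      _ ≤ (1 + b s) ^ k * T f s + (1 + b s) ^ k * ∑ i, T (L i f) s := by
          gcongr; exact hL f s
      _ ≤ C f * W s + ∑ i, C (L i f) * W s := by
          rw [Finset.mul_sum]
          exact add_le_add (hC f s) (Finset.sum_le_sum fun i _ => hC _ s)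
      _ = (C f + ∑ i, C (L i f)) * W s := by rw [add_mul, Finset.sum_mul]

theorem exists_norm_weightedBargmann_le (m : ℕ) (f : 𝓢(Heis n, ℂ)) :
    ∃ C : ℝ, ∀ s : {lam : ℝ // lam ≠ 0} × C2 n,
      ‖weightedBargmann s.1 s.2 f‖ ≤ C * (cConst n s.1 * ((1 + (s.1 : ℝ) ^ 2) ^ m)⁻¹) := by
  obtain ⟨C, hC⟩ := exists_one_add_pow_mul_le (S := {lam : ℝ // lam ≠ 0} × C2 n) (ι := Unit)
    (T := fun (f : 𝓢(Heis n, ℂ)) s => ‖weightedBargmann s.1 s.2 f‖)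
    (b := fun s => (s.1 : ℝ) ^ 2) (W := fun s => cConst n s.1 * (1 + (s.1 : ℝ) ^ 2) ^ n)
    (L := fun _ f => centralDeriv (centralDeriv f))
    (fun s => sq_nonneg _)
    (fun f s => by simpa using (sq_mul_norm_weightedBargmann s.1.2 s.2 f).le)
    (fun f => ⟨∫ p, ‖f p‖, fun s => norm_weightedBargmann_le s.1.2 s.2 f.integrable⟩) (m + n) f
  refine ⟨C, fun s => ?_⟩
  have hpos : 0 < 1 + (s.1 : ℝ) ^ 2 := by positivity
  rw [← mul_assoc, ← div_eq_mul_inv, le_div_iff₀' (pow_pos hpos m)]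
  refine le_of_mul_le_mul_right ?_ (pow_pos hpos n)
  calc _ = (1 + (s.1 : ℝ) ^ 2) ^ (m + n) * ‖weightedBargmann s.1 s.2 f‖ := by ring
    _ ≤ C * (cConst n s.1 * (1 + (s.1 : ℝ) ^ 2) ^ n) := hC s
    _ = _ := by ring

theorem exists_one_add_norm_pow_mul_le (m N : ℕ) (f : 𝓢(Heis n, ℂ)) :
    ∃ C : ℝ, ∀ s : {lam : ℝ // lam ≠ 0} × C2 n,
      (1 + Real.exp (-|(s.1 : ℝ)|) * ‖s.2‖) ^ N * ‖weightedBargmann s.1 s.2 f‖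
        ≤ C * (cConst n s.1 * ((1 + (s.1 : ℝ) ^ 2) ^ m)⁻¹) := by
  refine exists_one_add_pow_mul_le (ι := (Fin n ⊕ Fin n) ⊕ (Fin n ⊕ Fin n))
    (T := fun (f : 𝓢(Heis n, ℂ)) (s : {lam : ℝ // lam ≠ 0} × C2 n) =>
      ‖weightedBargmann s.1 s.2 f‖)
    (b := fun s => Real.exp (-|(s.1 : ℝ)|) * ‖s.2‖) (L := Sum.elim coordMul coordDeriv)
    (fun s => by positivity) (fun f s => ?_) (exists_norm_weightedBargmann_le m) N f
  rw [Real.exp_neg, mul_assoc, inv_mul_le_iff₀ (Real.exp_pos _), Fintype.sum_sum_type,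
    ← Finset.sum_add_distrib]
  exact norm_mul_norm_weightedBargmann_le s.1.2 s.2 f

theorem one_add_norm_pow_le (lam : ℝ) (ζ : C2 n) (N : ℕ) :
    (1 + ‖ζ‖) ^ N ≤ Real.exp (N * |lam|) * (1 + Real.exp (-|lam|) * ‖ζ‖) ^ N := by
  rw [Real.exp_nat_mul, ← mul_pow]
  gcongr
  rw [mul_add, ← mul_assoc, ← Real.exp_add, add_neg_cancel, Real.exp_zero, one_mul, mul_one]
  gcongr
  exact Real.one_le_exp (abs_nonneg _)

end TwistedBargmann

theorem mainTheorem11 (n : ℕ) (f : 𝓢(TwistedBargmann.Heis n, ℂ)) (m N : ℕ) :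
    ∃ C : ℝ, ∀ lam : ℝ, lam ≠ 0 → ∀ ζ : TwistedBargmann.C2 n,
      ‖TwistedBargmann.bargmann lam (TwistedBargmann.centralFourier f lam) ζ‖ *
          √(TwistedBargmann.weight lam ζ) ≤
        C * TwistedBargmann.cConst n lam * ((1 + lam ^ 2) ^ m)⁻¹ *
          Real.exp ((N : ℝ) * |lam|) * ((1 + ‖ζ‖) ^ N)⁻¹ := by
  obtain ⟨C, hC⟩ := TwistedBargmann.exists_one_add_norm_pow_mul_le m N f
  refine ⟨C, fun lam hlam ζ => ?_⟩
  have hbargmann : ‖TwistedBargmann.bargmann lam (TwistedBargmann.centralFourier f lam) ζ‖ *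
      √(TwistedBargmann.weight lam ζ) = ‖TwistedBargmann.weightedBargmann lam ζ f‖ := by
    rw [TwistedBargmann.weightedBargmann_eq hlam ζ f.integrable, norm_mul, Complex.norm_real,
      Real.norm_of_nonneg (Real.sqrt_nonneg _), mul_comm]
  rw [hbargmann, ← div_eq_mul_inv _ ((1 + ‖ζ‖) ^ N), le_div_iff₀' (by positivity)]
  calc (1 + ‖ζ‖) ^ N * ‖TwistedBargmann.weightedBargmann lam ζ f‖
      ≤ Real.exp (N * |lam|) * (1 + Real.exp (-|lam|) * ‖ζ‖) ^ N *
          ‖TwistedBargmann.weightedBargmann lam ζ f‖ := by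
        gcongr
        exact TwistedBargmann.one_add_norm_pow_le lam ζ N
    _ ≤ Real.exp (N * |lam|) * (C * (TwistedBargmann.cConst n lam * ((1 + lam ^ 2) ^ m)⁻¹)) := by
        rw [mul_assoc]
        exact mul_le_mul_of_nonneg_left (hC (⟨lam, hlam⟩, ζ)) (Real.exp_nonneg _)
    _ = C * TwistedBargmann.cConst n lam * ((1 + lam ^ 2) ^ m)⁻¹ * Real.exp (N * |lam|) := by
        ring
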